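/- Let $M=(\mathcal S,\mathcal A,P,r,\gamma)$ be a finite Markov decision process with rewards $r(s,a)\in[0,1]$ and discount factor $0<\gamma<1$. For a stochastic policy $\pi\in\Delta(\mathcal A)^{|\mathcal S|}$ let $$V^\pi(s_0)=\mathbb E\Big[\sum_{t\ge 0}\gamma^t r(s_t,a_t)\,\Big|\,\pi,s_0\Big],\qquad d^\pi_{s_0}(s)=(1-\gamma)\sum_{t\ge0}\gamma^t\Pr{}^\pi(s_t=s\mid s_0),$$ and for a distribution $\rho$ on $\mathcal S$ let $V^\pi(\rho)=\mathbb E_{s_0\sim\rho}[V^\pi(s_0)]$ and $d^\pi_\rho(s)=\mathbb E_{s_0\sim\rho}[d^\pi_{s_0}(s)]$. Fix a distribution $\mu$ on $\mathcal S$. Parameterize policies directly by the coordinates $\pi(a|s)$, so that $\nabla_\pi V^\pi(\mu)$ is the gradient in $\mathbb R^{|\mathcal S||\mathcal A|}$ of $V^\pi(\mu)$ (extended to a neighbourhood of the set of policies by the same formula, with transition matrix $P^\pi(s,s')=\sum_a\pi(a|s)P(s'|s,a)$). From an arbitrary initial policy $\pi^{(0)}$ run projected gradient ascent $$\pi^{(t+1)}=P_{\Delta(\mathcal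 A)^{|\mathcal S|}}\big(\pi^{(t)}+\eta\,\nabla_\pi V^{\pi^{(t)}}(\mu)\big),\qquad \eta=\frac{(1-\gamma)^3}{2\gamma|\mathcal A|},$$ where $P_{\Delta(\mathcal A)^{|\mathcal S|}}$ is the Euclidean projection onto the set of policies. Write $V^{(t)}=V^{\pi^{(t)}}$. Then for every distribution $\rho$ on $\mathcal S$, every policy $\pi^\star$ that maximizes $V^\pi(\rho)$ over all $\pi\in\Delta(\mathcal A)^{|\mathcal S|}$ (in particular every policy optimal from all states), with $V^\star(\rho)=V^{\pi^\star}(\rho)$, every $\epsilon>0$ and every integer $T\ge 2$, $$\min_{0\le t<T}\big\{V^\star(\rho)-V^{(t)}(\rho)\big\}\le\epsilon\qquad\text{whenever}\qquad T>\frac{64\,\gamma\,|\mathcal S||\mathcal A|}{(1-\gamma)^6\epsilon^2}\left\|\frac{d_\rho^{\pi^\star}}{\mu}\right\|_\infty^2 .$$ Here $\|d_\rho^{\pi^\star}/\mu\|_\infty=\max_s d_\rho^{\pi^\star}(s)/\mu(s)\in[0,\infty]$, with $x/0=\infty$ for $x>0$ and $0/0=0$. -/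

import Mathlib

/-- A finite discounted Markov decision process with states `S`, actions `A`, transition
probabilities `P s a s'` (from `s` to `s'` under `a`), rewards in `[0,1]` and discount factor
`γ ∈ [0,1)`.  Starting distributions are passed separately. -/
structure MDP (S A : Type*) [Fintype S] where
  P : S → A → S → ℝ
  P_mem : ∀ s a, P s a ∈ stdSimplex ℝ S
  r : S → A → ℝ
  r_mem : ∀ s a, r s a ∈ Set.Icc (0 : ℝ) 1
  γ : ℝ
  γ_nonneg : 0 ≤ γ
  γ_lt_one : γ < 1

/-- The set `Δ(A)^S` of stochastic policies in the direct parameterization,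
`π(a|s) = π (s, a)`, inside the Euclidean space `ℝ^{S × A}`. -/
def policySet (S A : Type*) [Fintype A] : Set (EuclideanSpace ℝ (S × A)) :=
  {π | ∀ s, (fun a => π (s, a)) ∈ stdSimplex ℝ A}

/-- `p` is the Euclidean projection of `x` onto `C`: a point of `C` closest to `x`. -/
def IsEuclideanProj {ι : Type*} [Fintype ι] (C : Set (EuclideanSpace ℝ ι))
    (x p : EuclideanSpace ℝ ι) : Prop :=
  p ∈ C ∧ ∀ q ∈ C, dist x p ≤ dist x q

namespace MDP

variable {S A : Type*} [Fintype S] [Fintype A] [DecidableEq S]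

/-- The state transition matrix under `π`: `P^π(s, s') = ∑ₐ π(a|s) P(s'|s,a)`. -/
noncomputable def transMatrix (M : MDP S A) (π : EuclideanSpace ℝ (S × A)) : Matrix S S ℝ :=
  Matrix.of fun s s' => ∑ a, π (s, a) * M.P s a s'

/-- `Pr^π(s_t = s | s_0)`. -/
noncomputable def stateProb (M : MDP S A) (π : EuclideanSpace ℝ (S × A)) (t : ℕ) (s₀ s : S) : ℝ :=
  (M.transMatrix π ^ t) s₀ s

/-- The value `V^π(s₀) = ∑ₜ γ^t E[r(s_t, a_t) | π, s_0 = s₀]`.  The formula is read for all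
`π ∈ ℝ^{S × A}`, so that it can be differentiated in the coordinates `π(a|s)`; the series
converges in a neighbourhood of the set of policies. -/
noncomputable def value (M : MDP S A) (π : EuclideanSpace ℝ (S × A)) (s₀ : S) : ℝ :=
  ∑' t : ℕ, M.γ ^ t * ∑ s, M.stateProb π t s₀ s * ∑ a, π (s, a) * M.r s a

/-- `V^π(ρ) = E_{s₀ ∼ ρ} V^π(s₀)`. -/
noncomputable def valueOf (M : MDP S A) (π : EuclideanSpace ℝ (S × A)) (ρ : S → ℝ) : ℝ :=
  ∑ s₀, ρ s₀ * M.value π s₀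

/-- The discounted state visitation distribution
`d_{s₀}^π(s) = (1-γ) ∑ₜ γ^t Pr^π(s_t = s | s_0 = s₀)`. -/
noncomputable def visit (M : MDP S A) (π : EuclideanSpace ℝ (S × A)) (s₀ s : S) : ℝ :=
  (1 - M.γ) * ∑' t : ℕ, M.γ ^ t * M.stateProb π t s₀ s

/-- `d_ρ^π(s) = E_{s₀ ∼ ρ} d_{s₀}^π(s)`. -/
noncomputable def visitOf (M : MDP S A) (π : EuclideanSpace ℝ (S × A)) (ρ : S → ℝ) (s : S) : ℝ :=
  ∑ s₀, ρ s₀ * M.visit π s₀ s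

/-- The distribution mismatch coefficient `‖d_ρ^π / μ‖_∞ ∈ [0, ∞]`.  Division is that of
`[0, ∞]`: `x / 0 = ∞` for `x > 0`, and `0 / 0 = 0`. -/
noncomputable def mismatch (M : MDP S A) (π : EuclideanSpace ℝ (S × A)) (ρ μ : S → ℝ) : ENNReal :=
  ⨆ s, ENNReal.ofReal (M.visitOf π ρ s) / ENNReal.ofReal (μ s)

/-- `π'` is an optimal policy for the starting distribution `ρ`:
`π' ∈ argmax_π V^π(ρ)`, over all stochastic policies. -/
def IsOptimalFor (M : MDP S A) (ρ : S → ℝ) (π' : EuclideanSpace ℝ (S × A)) : Prop :=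
  π' ∈ policySet S A ∧ ∀ π ∈ policySet S A, M.valueOf π ρ ≤ M.valueOf π' ρ

/-- `π 0, π 1, …` are the iterates of projected gradient ascent on `V^π(μ)` over the policies,
with stepsize `η`, from an arbitrary initial policy:
`π (t+1) = Proj (π t + η ∇_π V^{π t}(μ))`. -/
def IsProjGradAscent (M : MDP S A) (μ : S → ℝ) (η : ℝ)
    (π : ℕ → EuclideanSpace ℝ (S × A)) : Prop :=
  π 0 ∈ policySet S A ∧
    ∀ t, IsEuclideanProj (policySet S A)
      (π t + η • gradient (fun θ : EuclideanSpace ℝ (S × A) => M.valueOf θ μ) (π t)) (π (t + 1))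

end MDP

/-! Write `R^θ = (1 - γ P^θ)⁻¹` and let `q^π(w)(s) = ∑ₐ w(s,a) Q^π(s,a)`. The Bellman equation gives
the exact identity `V^θ - V^π = R^θ q^π(θ - π)` (`value_sub_value`), and everything rests on it.
Replacing `R^θ` by `R^π` leaves a quadratic error, so `w ↦ μ · R^π q^π(w)` is the derivative of
`V(μ)`. On policies it is Lipschitz with constant `β = 2γ|A|/(1-γ)³`, the inverse of the stepsize.
Each step therefore gains at least `β/2` times its squared length. Values lie in `[0, 1/(1-γ)]`, so
one of the first `T - 1` steps is short, and its endpoint is nearly stationary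
(`IsProjGradAscent.dirDeriv_le`). Although `V` is not concave, near-stationarity suffices: the same
identity bounds the gap to `π⋆` by `D/(1-γ)` times a directional derivative towards some policy, `D`
being the mismatch coefficient (`exists_valueOf_sub_le_dirDeriv`). This direction has squared length
at most `2|S|`. -/

namespace MDP

/-! ### Resolvent of the transition matrix, performance difference and norm bounds. -/

section Resolvent

attribute [local instance] Matrix.linftyOpNormedRing Matrix.linftyOpNormedAlgebra

variable {S A : Type*} [Fintype S] [Fintype A]

/-- The expected one-step reward `∑ₐ θ(a|s) r(s, a)`. -/
noncomputable def expReward (M : MDP S A) (θ : EuclideanSpace ℝ (S × A)) (s : S) : ℝ :=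
  ∑ a, θ (s, a) * M.r s a

theorem transMatrix_sub (M : MDP S A) (θ θ' : EuclideanSpace ℝ (S × A)) :
    M.transMatrix (θ - θ') = M.transMatrix θ - M.transMatrix θ' := by
  ext s s'
  simp [transMatrix, sub_mul]

theorem transMatrix_add (M : MDP S A) (θ θ' : EuclideanSpace ℝ (S × A)) :
    M.transMatrix (θ + θ') = M.transMatrix θ + M.transMatrix θ' := by
  ext s s'
  simp [transMatrix, add_mul, Finset.sum_add_distrib]

theorem transMatrix_smul (M : MDP S A) (c : ℝ) (θ : EuclideanSpace ℝ (S × A)) :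
    M.transMatrix (c • θ) = c • M.transMatrix θ := by
  ext s s'
  simp [transMatrix, mul_assoc, Finset.mul_sum]

theorem expReward_sub (M : MDP S A) (θ θ' : EuclideanSpace ℝ (S × A)) :
    M.expReward (θ - θ') = M.expReward θ - M.expReward θ' := by
  ext s
  simp [expReward, sub_mul]

theorem expReward_add (M : MDP S A) (θ θ' : EuclideanSpace ℝ (S × A)) :
    M.expReward (θ + θ') = M.expReward θ + M.expReward θ' := by
  ext s
  simp [expReward, add_mul, Finset.sum_add_distrib]

theorem expReward_smul (M : MDP S A) (c : ℝ) (θ : EuclideanSpace ℝ (S × A)) :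
    M.expReward (c • θ) = c • M.expReward θ := by
  ext s
  simp [expReward, mul_assoc, Finset.mul_sum]

theorem sum_abs_mul_le (M : MDP S A) (w : EuclideanSpace ℝ (S × A)) (s : S) :
    ∑ s', |M.transMatrix w s s'| ≤ ∑ a, |w (s, a)| := by
  calc ∑ s', |M.transMatrix w s s'| ≤ ∑ s', ∑ a, |w (s, a)| * M.P s a s' := by
        refine Finset.sum_le_sum fun s' _ => ?_
        refine (Finset.abs_sum_le_sum_abs _ _).trans_eq (Finset.sum_congr rfl fun a _ => ?_)
        rw [abs_mul, abs_of_nonneg ((M.P_mem s a).1 s')]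
    _ = ∑ a, |w (s, a)| := by
        rw [Finset.sum_comm]
        refine Finset.sum_congr rfl fun a _ => ?_
        rw [← Finset.mul_sum, (M.P_mem s a).2, mul_one]

theorem abs_expReward_le (M : MDP S A) (w : EuclideanSpace ℝ (S × A)) (s : S) :
    |M.expReward w s| ≤ ∑ a, |w (s, a)| := by
  refine (Finset.abs_sum_le_sum_abs _ _).trans (Finset.sum_le_sum fun a _ => ?_)
  rw [abs_mul, abs_of_nonneg (M.r_mem s a).1]
  exact mul_le_of_le_one_right (abs_nonneg _) (M.r_mem s a).2

/-- Cauchy–Schwarz on a single row of `w`; every factor `√|A|` below comes from here. -/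
theorem sum_abs_le_sqrt_card_mul_norm (w : EuclideanSpace ℝ (S × A)) (s : S) :
    ∑ a, |w (s, a)| ≤ √(Fintype.card A) * ‖w‖ := by
  have h1 : (∑ a, |w (s, a)|) ^ 2 ≤ Fintype.card A * ∑ a, |w (s, a)| ^ 2 := by
    simpa using sq_sum_le_card_mul_sum_sq (s := Finset.univ) (f := fun a => |w (s, a)|)
  have h2 : ∑ a, |w (s, a)| ^ 2 ≤ ‖w‖ ^ 2 := by
    rw [EuclideanSpace.norm_sq_eq, Fintype.sum_prod_type]
    exact Finset.single_le_sum (f := fun s => ∑ a, ‖w (s, a)‖ ^ 2)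
      (fun _ _ => Finset.sum_nonneg fun _ _ => sq_nonneg _) (Finset.mem_univ s)
  refine abs_le_of_sq_le_sq' ?_ (by positivity) |>.2
  rw [mul_pow, Real.sq_sqrt (Nat.cast_nonneg _)]
  exact h1.trans (mul_le_mul_of_nonneg_left h2 (Nat.cast_nonneg _))

omit [Fintype S] in
theorem sum_abs_eq_one_of_mem_policySet {π : EuclideanSpace ℝ (S × A)}
    (hπ : π ∈ policySet S A) (s : S) : ∑ a, |π (s, a)| = 1 := by
  rw [← (hπ s).2]
  exact Finset.sum_congr rfl fun a _ => abs_of_nonneg ((hπ s).1 a)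

theorem norm_expReward_le (M : MDP S A) (w : EuclideanSpace ℝ (S × A)) :
    ‖M.expReward w‖ ≤ √(Fintype.card A) * ‖w‖ :=
  (pi_norm_le_iff_of_nonneg (by positivity)).2 fun s =>
    (M.abs_expReward_le w s).trans (sum_abs_le_sqrt_card_mul_norm w s)

theorem norm_expReward_le_one (M : MDP S A) {π : EuclideanSpace ℝ (S × A)}
    (hπ : π ∈ policySet S A) : ‖M.expReward π‖ ≤ 1 :=
  (pi_norm_le_iff_of_nonneg zero_le_one).2 fun s =>
    (M.abs_expReward_le π s).trans_eq (sum_abs_eq_one_of_mem_policySet hπ s)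

variable [DecidableEq S]

/-- The matrix `∑ₜ γ^t (P^θ)^t`, the inverse of `1 - γ P^θ`. -/
noncomputable def resolvent (M : MDP S A) (θ : EuclideanSpace ℝ (S × A)) : Matrix S S ℝ :=
  Matrix.of fun s s' => ∑' t : ℕ, M.γ ^ t * M.stateProb θ t s s'

/-- The pairing `∑ₐ w(s, a) Q^θ(s, a)` of a direction `w` with the action values of `θ`. -/
noncomputable def qPairing (M : MDP S A) (θ w : EuclideanSpace ℝ (S × A)) : S → ℝ :=
  M.expReward w + M.γ • (M.transMatrix w).mulVec (M.value θ)

/-- The matrix norm in force is the largest absolute row sum. Stochastic matrices then have norm at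
most 1, so the Neumann series converges at every policy and nearby. -/
theorem norm_matrix_le {B : Matrix S S ℝ} {c : ℝ} (hc : 0 ≤ c)
    (h : ∀ s, ∑ s', |B s s'| ≤ c) : ‖B‖ ≤ c := by
  lift c to NNReal using hc
  rw [Matrix.linfty_opNorm_def, NNReal.coe_le_coe]
  refine Finset.sup_le fun s _ => ?_
  rw [← NNReal.coe_le_coe]
  simpa using h s

theorem norm_transMatrix_le (M : MDP S A) (w : EuclideanSpace ℝ (S × A)) :
    ‖M.transMatrix w‖ ≤ √(Fintype.card A) * ‖w‖ :=
  norm_matrix_le (by positivity) fun s =>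
    (M.sum_abs_mul_le w s).trans (sum_abs_le_sqrt_card_mul_norm w s)

theorem norm_transMatrix_le_one (M : MDP S A) {π : EuclideanSpace ℝ (S × A)}
    (hπ : π ∈ policySet S A) : ‖M.transMatrix π‖ ≤ 1 :=
  norm_matrix_le zero_le_one fun s =>
    (M.sum_abs_mul_le π s).trans_eq (sum_abs_eq_one_of_mem_policySet hπ s)

theorem norm_smul_transMatrix_le (M : MDP S A) {π : EuclideanSpace ℝ (S × A)}
    (hπ : π ∈ policySet S A) : ‖M.γ • M.transMatrix π‖ ≤ M.γ := by
  rw [norm_smul, Real.norm_of_nonneg M.γ_nonneg]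
  exact mul_le_of_le_one_right M.γ_nonneg (M.norm_transMatrix_le_one hπ)

instance : HasSummableGeomSeries (Matrix S S ℝ) :=
  haveI : CompleteSpace (Matrix S S ℝ) := FiniteDimensional.complete ℝ _
  inferInstance

theorem hasSum_resolvent (M : MDP S A) {θ : EuclideanSpace ℝ (S × A)}
    (hθ : ‖M.γ • M.transMatrix θ‖ < 1) (s s' : S) :
    HasSum (fun t : ℕ => M.γ ^ t * M.stateProb θ t s s')
      ((∑' t : ℕ, (M.γ • M.transMatrix θ) ^ t) s s') := by
  have h := (summable_geometric_of_norm_lt_one hθ).hasSum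
  have h' := h.mapL (LinearMap.toContinuousLinearMap (Matrix.entryLinearMap ℝ ℝ s s'))
  have e : (fun t : ℕ => M.γ ^ t * M.stateProb θ t s s') = fun t : ℕ =>
      LinearMap.toContinuousLinearMap (Matrix.entryLinearMap ℝ ℝ s s')
        ((M.γ • M.transMatrix θ) ^ t) := by
    funext t
    simp [smul_pow, stateProb]
  rw [e]
  exact h'

theorem resolvent_eq_tsum (M : MDP S A) {θ : EuclideanSpace ℝ (S × A)}
    (hθ : ‖M.γ • M.transMatrix θ‖ < 1) :
    M.resolvent θ = ∑' t : ℕ, (M.γ • M.transMatrix θ) ^ t := by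
  ext s s'
  exact (M.hasSum_resolvent hθ s s').tsum_eq

theorem hasSum_resolvent_apply (M : MDP S A) {θ : EuclideanSpace ℝ (S × A)}
    (hθ : ‖M.γ • M.transMatrix θ‖ < 1) (s s' : S) :
    HasSum (fun t : ℕ => M.γ ^ t * M.stateProb θ t s s') (M.resolvent θ s s') := by
  rw [M.resolvent_eq_tsum hθ]
  exact M.hasSum_resolvent hθ s s'

theorem resolvent_mul (M : MDP S A) {θ : EuclideanSpace ℝ (S × A)}
    (hθ : ‖M.γ • M.transMatrix θ‖ < 1) :
    M.resolvent θ * (1 - M.γ • M.transMatrix θ) = 1 := by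
  rw [M.resolvent_eq_tsum hθ]
  exact geom_series_mul_neg _ hθ

theorem mul_resolvent (M : MDP S A) {θ : EuclideanSpace ℝ (S × A)}
    (hθ : ‖M.γ • M.transMatrix θ‖ < 1) :
    (1 - M.γ • M.transMatrix θ) * M.resolvent θ = 1 := by
  rw [M.resolvent_eq_tsum hθ]
  exact mul_neg_geom_series _ hθ

theorem norm_resolvent_le [Nonempty S] (M : MDP S A) {θ : EuclideanSpace ℝ (S × A)}
    (hθ : ‖M.γ • M.transMatrix θ‖ < 1) :
    ‖M.resolvent θ‖ ≤ (1 - ‖M.γ • M.transMatrix θ‖)⁻¹ := by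
  rw [M.resolvent_eq_tsum hθ]
  refine (tsum_geometric_le_of_norm_lt_one _ hθ).trans_eq ?_
  rw [norm_one, sub_self, zero_add]

theorem norm_resolvent_le_of_mem [Nonempty S] (M : MDP S A) {π : EuclideanSpace ℝ (S × A)}
    (hπ : π ∈ policySet S A) : ‖M.resolvent π‖ ≤ (1 - M.γ)⁻¹ := by
  have h := M.norm_smul_transMatrix_le hπ
  have h1 := M.γ_lt_one
  refine (M.norm_resolvent_le (h.trans_lt h1)).trans ?_
  gcongr

theorem value_eq_mulVec (M : MDP S A) {θ : EuclideanSpace ℝ (S × A)}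
    (hθ : ‖M.γ • M.transMatrix θ‖ < 1) :
    M.value θ = (M.resolvent θ).mulVec (M.expReward θ) := by
  ext s₀
  have h := hasSum_sum fun s (_ : s ∈ Finset.univ) =>
    (M.hasSum_resolvent_apply hθ s₀ s).mul_right (M.expReward θ s)
  rw [value, Matrix.mulVec, dotProduct, ← h.tsum_eq]
  refine tsum_congr fun t => ?_
  simp [Finset.mul_sum, expReward, mul_assoc]

/-- Performance difference: reward and transitions are linear in the policy, so subtracting two
Bellman equations gives `q^π(θ - π) = (1 - γ P^θ)(V^θ - V^π)`. Only convergence is required, so it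
also holds off the policy set, where derivatives need it. -/
theorem value_sub_value (M : MDP S A) {θ π : EuclideanSpace ℝ (S × A)}
    (hθ : ‖M.γ • M.transMatrix θ‖ < 1) (hπ : ‖M.γ • M.transMatrix π‖ < 1) :
    M.value θ - M.value π = (M.resolvent θ).mulVec (M.qPairing π (θ - π)) := by
  have key : ∀ {η : EuclideanSpace ℝ (S × A)}, ‖M.γ • M.transMatrix η‖ < 1 →
      M.expReward η = M.value η - M.γ • (M.transMatrix η).mulVec (M.value η) := by
    intro η hη
    have h : (1 - M.γ • M.transMatrix η).mulVec (M.value η) = M.expReward η := by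
      rw [M.value_eq_mulVec hη, Matrix.mulVec_mulVec, M.mul_resolvent hη, Matrix.one_mulVec]
    rw [← h, Matrix.sub_mulVec, Matrix.one_mulVec, Matrix.smul_mulVec]
  have h : M.qPairing π (θ - π) =
      (1 - M.γ • M.transMatrix θ).mulVec (M.value θ - M.value π) := by
    rw [qPairing, expReward_sub, transMatrix_sub, key hθ, key hπ]
    simp only [Matrix.sub_mulVec, Matrix.one_mulVec, Matrix.smul_mulVec, Matrix.mulVec_sub,
      smul_sub]
    abel
  rw [h, Matrix.mulVec_mulVec, M.resolvent_mul hθ, Matrix.one_mulVec]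

theorem resolvent_sub_resolvent (M : MDP S A) {θ π : EuclideanSpace ℝ (S × A)}
    (hθ : ‖M.γ • M.transMatrix θ‖ < 1) (hπ : ‖M.γ • M.transMatrix π‖ < 1) :
    M.resolvent θ - M.resolvent π =
      M.resolvent θ * (M.γ • M.transMatrix (θ - π)) * M.resolvent π := by
  have h : M.γ • M.transMatrix (θ - π) =
      (1 - M.γ • M.transMatrix π) - (1 - M.γ • M.transMatrix θ) := by
    rw [transMatrix_sub, smul_sub]; abel
  rw [h, mul_sub, sub_mul, M.resolvent_mul hθ, mul_assoc, M.mul_resolvent hπ, mul_one, one_mul]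

theorem norm_value_le [Nonempty S] (M : MDP S A) {π : EuclideanSpace ℝ (S × A)}
    (hπ : π ∈ policySet S A) : ‖M.value π‖ ≤ (1 - M.γ)⁻¹ := by
  have h := (M.norm_smul_transMatrix_le hπ).trans_lt M.γ_lt_one
  rw [M.value_eq_mulVec h]
  refine (Matrix.linfty_opNorm_mulVec _ _).trans ?_
  have := M.norm_resolvent_le_of_mem hπ
  exact (mul_le_of_le_one_right (norm_nonneg _) (M.norm_expReward_le_one hπ)).trans this

theorem norm_qPairing_le [Nonempty S] (M : MDP S A) {π : EuclideanSpace ℝ (S × A)}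
    (hπ : π ∈ policySet S A) (w : EuclideanSpace ℝ (S × A)) :
    ‖M.qPairing π w‖ ≤ √(Fintype.card A) * ‖w‖ * (1 - M.γ)⁻¹ := by
  have h1 : 0 < 1 - M.γ := sub_pos.2 M.γ_lt_one
  have h2 : ‖(M.transMatrix w).mulVec (M.value π)‖ ≤
      √(Fintype.card A) * ‖w‖ * (1 - M.γ)⁻¹ :=
    (Matrix.linfty_opNorm_mulVec _ _).trans
      (mul_le_mul (M.norm_transMatrix_le w) (M.norm_value_le hπ) (norm_nonneg _) (by positivity))
  calc ‖M.qPairing π w‖ ≤ ‖M.expReward w‖ + M.γ * ‖(M.transMatrix w).mulVec (M.value π)‖ := by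
        refine (norm_add_le _ _).trans_eq ?_
        rw [norm_smul, Real.norm_of_nonneg M.γ_nonneg]
    _ ≤ √(Fintype.card A) * ‖w‖ + M.γ * (√(Fintype.card A) * ‖w‖ * (1 - M.γ)⁻¹) :=
        add_le_add (M.norm_expReward_le w) (mul_le_mul_of_nonneg_left h2 M.γ_nonneg)
    _ = √(Fintype.card A) * ‖w‖ * (1 - M.γ)⁻¹ := by field_simp; ring

theorem norm_resolvent_sub_mulVec_le [Nonempty S] (M : MDP S A)
    {θ π : EuclideanSpace ℝ (S × A)} (hθ : ‖M.γ • M.transMatrix θ‖ < 1)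
    (hπ : π ∈ policySet S A) {c : ℝ} (hc : ‖M.resolvent θ‖ ≤ c) (v : S → ℝ) :
    ‖(M.resolvent θ - M.resolvent π).mulVec v‖ ≤
      c * (M.γ * (√(Fintype.card A) * ‖θ - π‖)) * (1 - M.γ)⁻¹ * ‖v‖ := by
  have hπ' := (M.norm_smul_transMatrix_le hπ).trans_lt M.γ_lt_one
  have h1 : 0 < 1 - M.γ := sub_pos.2 M.γ_lt_one
  have h2 : ‖M.γ • M.transMatrix (θ - π)‖ ≤ M.γ * (√(Fintype.card A) * ‖θ - π‖) := by
    rw [norm_smul, Real.norm_of_nonneg M.γ_nonneg]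
    exact mul_le_mul_of_nonneg_left (M.norm_transMatrix_le _) M.γ_nonneg
  have h3 := M.norm_resolvent_le_of_mem hπ
  have h0 := M.γ_nonneg
  have hc0 := (norm_nonneg _).trans hc
  rw [M.resolvent_sub_resolvent hθ hπ']
  refine (Matrix.linfty_opNorm_mulVec _ _).trans
    (mul_le_mul_of_nonneg_right ?_ (norm_nonneg _))
  refine (norm_mul_le _ _).trans (mul_le_mul ?_ h3 (norm_nonneg _) (by positivity))
  exact (norm_mul_le _ _).trans (mul_le_mul hc h2 (norm_nonneg _) hc0)

end Resolvent

end MDP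

namespace MDP

/-! ### Policy gradient and smoothness of the value. -/

section Gradient

attribute [local instance] Matrix.linftyOpNormedRing Matrix.linftyOpNormedAlgebra

variable {S A : Type*} [Fintype S] [Fintype A] [DecidableEq S]

omit [DecidableEq S] in
theorem abs_dotProduct_le_norm {μ : S → ℝ} (hμ : μ ∈ stdSimplex ℝ S) (v : S → ℝ) :
    |dotProduct μ v| ≤ ‖v‖ := by
  calc |dotProduct μ v| ≤ ∑ s, μ s * ‖v‖ := by
        refine (Finset.abs_sum_le_sum_abs _ _).trans (Finset.sum_le_sum fun s _ => ?_)
        rw [abs_mul, abs_of_nonneg (hμ.1 s)]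
        exact mul_le_mul_of_nonneg_left (norm_le_pi_norm v s) (hμ.1 s)
    _ = ‖v‖ := by rw [← Finset.sum_mul, hμ.2, one_mul]

/-- The directional derivative `∇V^π(μ) · w`, linear in `w` (policy gradient theorem). -/
noncomputable def dirDeriv (M : MDP S A) (μ : S → ℝ) (π : EuclideanSpace ℝ (S × A)) :
    EuclideanSpace ℝ (S × A) →ₗ[ℝ] ℝ where
  toFun w := dotProduct μ ((M.resolvent π).mulVec (M.qPairing π w))
  map_add' w w' := by
    have h : M.qPairing π (w + w') = M.qPairing π w + M.qPairing π w' := by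
      simp only [qPairing, expReward_add, transMatrix_add, Matrix.add_mulVec, smul_add]
      abel
    rw [h, Matrix.mulVec_add, dotProduct_add]
  map_smul' c w := by
    have h : M.qPairing π (c • w) = c • M.qPairing π w := by
      simp only [qPairing, expReward_smul, transMatrix_smul, Matrix.smul_mulVec, smul_add,
        smul_comm c M.γ]
    rw [h, Matrix.mulVec_smul, dotProduct_smul, RingHom.id_apply]

theorem dirDeriv_apply (M : MDP S A) (μ : S → ℝ) (π w : EuclideanSpace ℝ (S × A)) :
    M.dirDeriv μ π w = dotProduct μ ((M.resolvent π).mulVec (M.qPairing π w)) := rfl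

theorem valueOf_sub_valueOf (M : MDP S A) (μ : S → ℝ) {θ π : EuclideanSpace ℝ (S × A)}
    (hθ : ‖M.γ • M.transMatrix θ‖ < 1) (hπ : ‖M.γ • M.transMatrix π‖ < 1) :
    M.valueOf θ μ - M.valueOf π μ =
      dotProduct μ ((M.resolvent θ).mulVec (M.qPairing π (θ - π))) := by
  rw [← M.value_sub_value hθ hπ, dotProduct_sub]
  rfl

/-- The remainder is exactly `μ · (R^θ - R^π) q^π(θ - π)`, a product of two factors of order `‖θ -
π‖`. The bound `c` is left free to serve both differentiation near `π` and the sharp estimate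
between policies. -/
theorem abs_valueOf_sub_sub_dirDeriv_le [Nonempty S] (M : MDP S A) {μ : S → ℝ}
    (hμ : μ ∈ stdSimplex ℝ S) {θ π : EuclideanSpace ℝ (S × A)}
    (hθ : ‖M.γ • M.transMatrix θ‖ < 1) (hπ : π ∈ policySet S A)
    {c : ℝ} (hc : ‖M.resolvent θ‖ ≤ c) :
    |M.valueOf θ μ - M.valueOf π μ - M.dirDeriv μ π (θ - π)| ≤
      c * M.γ * Fintype.card A / (1 - M.γ) ^ 2 * ‖θ - π‖ ^ 2 := by
  have h1 : 0 < 1 - M.γ := sub_pos.2 M.γ_lt_one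
  have h0 := M.γ_nonneg
  have hc0 := (norm_nonneg _).trans hc
  rw [M.valueOf_sub_valueOf μ hθ ((M.norm_smul_transMatrix_le hπ).trans_lt M.γ_lt_one),
    dirDeriv_apply, ← dotProduct_sub, ← Matrix.sub_mulVec]
  refine (abs_dotProduct_le_norm hμ _).trans
    ((M.norm_resolvent_sub_mulVec_le hθ hπ hc _).trans ?_)
  refine (mul_le_mul_of_nonneg_left (M.norm_qPairing_le hπ (θ - π)) (by positivity)).trans_eq ?_
  have hA : (Fintype.card A : ℝ) = √(Fintype.card A) * √(Fintype.card A) :=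
    (Real.mul_self_sqrt (Nat.cast_nonneg _)).symm
  nth_rw 3 [hA]
  field_simp

theorem hasFDerivAt_valueOf [Nonempty S] (M : MDP S A) {μ : S → ℝ}
    (hμ : μ ∈ stdSimplex ℝ S) {π : EuclideanSpace ℝ (S × A)} (hπ : π ∈ policySet S A) :
    HasFDerivAt (fun θ : EuclideanSpace ℝ (S × A) => M.valueOf θ μ)
      (LinearMap.toContinuousLinearMap (M.dirDeriv μ π)) π := by
  have h1 : 0 < 1 - M.γ := sub_pos.2 M.γ_lt_one
  have h0 := M.γ_nonneg
  have hcont : Continuous fun θ : EuclideanSpace ℝ (S × A) =>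
      M.γ * (√(Fintype.card A) * ‖θ - π‖) := by fun_prop
  -- This radius keeps `‖γ P^θ‖` below `(1+γ)/2`, hence `‖R^θ‖ ≤ 2/(1-γ)`.
  have hev : ∀ᶠ θ in nhds π, M.γ * (√(Fintype.card A) * ‖θ - π‖) < (1 - M.γ) / 2 :=
    hcont.continuousAt.eventually_lt_const (by simpa using h1)
  rw [hasFDerivAt_iff_isLittleO]
  have hO : (fun θ : EuclideanSpace ℝ (S × A) => M.valueOf θ μ - M.valueOf π μ -
      LinearMap.toContinuousLinearMap (M.dirDeriv μ π) (θ - π)) =O[nhds π]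
        fun θ => ‖θ - π‖ ^ 2 := by
    refine Asymptotics.IsBigO.of_bound
      (((1 - M.γ) / 2)⁻¹ * M.γ * Fintype.card A / (1 - M.γ) ^ 2) ?_
    filter_upwards [hev] with θ hθ
    have hX : ‖M.γ • M.transMatrix θ‖ ≤ M.γ + (1 - M.γ) / 2 := by
      have e : M.γ • M.transMatrix θ = M.γ • M.transMatrix π + M.γ • M.transMatrix (θ - π) := by
        rw [← smul_add, ← transMatrix_add, add_sub_cancel]
      rw [e]
      refine (norm_add_le _ _).trans (add_le_add (M.norm_smul_transMatrix_le hπ) ?_)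
      rw [norm_smul, Real.norm_of_nonneg h0]
      exact (mul_le_mul_of_nonneg_left (M.norm_transMatrix_le _) h0).trans hθ.le
    have hX1 : ‖M.γ • M.transMatrix θ‖ < 1 := by linarith
    have hc : ‖M.resolvent θ‖ ≤ ((1 - M.γ) / 2)⁻¹ := by
      refine (M.norm_resolvent_le hX1).trans ?_
      gcongr
      linarith
    rw [norm_pow, norm_norm]
    exact M.abs_valueOf_sub_sub_dirDeriv_le hμ hX1 hπ hc
  refine hO.trans_isLittleO ?_
  have := (Asymptotics.isLittleO_pow_id (𝕜 := ℝ) (n := 2) one_lt_two).comp_tendsto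
    (show Filter.Tendsto (fun θ : EuclideanSpace ℝ (S × A) => ‖θ - π‖) (nhds π) (nhds 0) from
      (tendsto_iff_norm_sub_tendsto_zero.1 Filter.tendsto_id))
  exact this.norm_right.congr_right (fun θ => by simp) |>.of_norm_right

theorem inner_gradient_valueOf [Nonempty S] (M : MDP S A) {μ : S → ℝ}
    (hμ : μ ∈ stdSimplex ℝ S) {π : EuclideanSpace ℝ (S × A)} (hπ : π ∈ policySet S A)
    (w : EuclideanSpace ℝ (S × A)) :
    inner ℝ (gradient (fun θ : EuclideanSpace ℝ (S × A) => M.valueOf θ μ) π) w =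
      M.dirDeriv μ π w := by
  rw [gradient, InnerProductSpace.toDual_symm_apply, (M.hasFDerivAt_valueOf hμ hπ).fderiv]
  rfl

/-- The variation of `R` and that of `Q` each contribute `γ|A|/(1-γ)³`, whence the factor 2. -/
theorem abs_dirDeriv_sub_le [Nonempty S] (M : MDP S A) {μ : S → ℝ}
    (hμ : μ ∈ stdSimplex ℝ S) {θ π : EuclideanSpace ℝ (S × A)}
    (hθ : θ ∈ policySet S A) (hπ : π ∈ policySet S A) (w : EuclideanSpace ℝ (S × A)) :
    |M.dirDeriv μ θ w - M.dirDeriv μ π w| ≤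
      2 * M.γ * Fintype.card A / (1 - M.γ) ^ 3 * ‖θ - π‖ * ‖w‖ := by
  have h1 : 0 < 1 - M.γ := sub_pos.2 M.γ_lt_one
  have h0 := M.γ_nonneg
  have hθ' := (M.norm_smul_transMatrix_le hθ).trans_lt M.γ_lt_one
  have hπ' := (M.norm_smul_transMatrix_le hπ).trans_lt M.γ_lt_one
  have hRθ := M.norm_resolvent_le_of_mem hθ
  have e : M.dirDeriv μ θ w - M.dirDeriv μ π w =
      dotProduct μ ((M.resolvent θ - M.resolvent π).mulVec (M.qPairing π w)) +
      dotProduct μ ((M.resolvent θ).mulVec (M.qPairing θ w - M.qPairing π w)) := by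
    simp only [dirDeriv_apply, Matrix.sub_mulVec, Matrix.mulVec_sub, dotProduct_sub]
    ring
  have hq : M.qPairing θ w - M.qPairing π w =
      M.γ • (M.transMatrix w).mulVec (M.value θ - M.value π) := by
    simp only [qPairing, Matrix.mulVec_sub, smul_sub]
    abel
  have hV : ‖M.value θ - M.value π‖ ≤
      (1 - M.γ)⁻¹ * (√(Fintype.card A) * ‖θ - π‖ * (1 - M.γ)⁻¹) := by
    rw [M.value_sub_value hθ' hπ']
    exact (Matrix.linfty_opNorm_mulVec _ _).trans
      (mul_le_mul hRθ (M.norm_qPairing_le hπ _) (norm_nonneg _) (by positivity))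
  have hq' : ‖M.qPairing θ w - M.qPairing π w‖ ≤ M.γ * (√(Fintype.card A) * ‖w‖ *
      ((1 - M.γ)⁻¹ * (√(Fintype.card A) * ‖θ - π‖ * (1 - M.γ)⁻¹))) := by
    rw [hq, norm_smul, Real.norm_of_nonneg h0]
    refine mul_le_mul_of_nonneg_left ((Matrix.linfty_opNorm_mulVec _ _).trans ?_) h0
    exact mul_le_mul (M.norm_transMatrix_le w) hV (norm_nonneg _) (by positivity)
  have hB : |dotProduct μ ((M.resolvent θ).mulVec (M.qPairing θ w - M.qPairing π w))| ≤
      (1 - M.γ)⁻¹ * (M.γ * (√(Fintype.card A) * ‖w‖ *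
        ((1 - M.γ)⁻¹ * (√(Fintype.card A) * ‖θ - π‖ * (1 - M.γ)⁻¹)))) :=
    (abs_dotProduct_le_norm hμ _).trans ((Matrix.linfty_opNorm_mulVec _ _).trans
      (mul_le_mul hRθ hq' (norm_nonneg _) (by positivity)))
  have hC : |dotProduct μ ((M.resolvent θ - M.resolvent π).mulVec (M.qPairing π w))| ≤
      (1 - M.γ)⁻¹ * (M.γ * (√(Fintype.card A) * ‖θ - π‖)) * (1 - M.γ)⁻¹ *
        (√(Fintype.card A) * ‖w‖ * (1 - M.γ)⁻¹) :=
    (abs_dotProduct_le_norm hμ _).trans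
      ((M.norm_resolvent_sub_mulVec_le hθ' hπ hRθ _).trans
        (mul_le_mul_of_nonneg_left (M.norm_qPairing_le hπ w) (by positivity)))
  rw [e]
  refine (abs_add_le _ _).trans ((add_le_add hC hB).trans_eq ?_)
  have hA : (Fintype.card A : ℝ) = √(Fintype.card A) * √(Fintype.card A) :=
    (Real.mul_self_sqrt (Nat.cast_nonneg _)).symm
  nth_rw 5 [hA]
  field_simp
  ring

end Gradient

end MDP

/-! ### Projection onto the policy set and its diameter. -/

theorem IsEuclideanProj.inner_sub_le_zero {ι : Type*} [Fintype ι]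
    {C : Set (EuclideanSpace ℝ ι)} (hC : Convex ℝ C) {x p : EuclideanSpace ℝ ι}
    (h : IsEuclideanProj C x p) {z : EuclideanSpace ℝ ι} (hz : z ∈ C) :
    inner ℝ (x - p) (z - p) ≤ 0 := by
  refine (norm_eq_iInf_iff_real_inner_le_zero hC h.1).1 ?_ z hz
  have : Nonempty C := ⟨⟨p, h.1⟩⟩
  refine le_antisymm (le_ciInf fun w => ?_) (ciInf_le (f := fun w : C => ‖x - w‖) ⟨0, ?_⟩ ⟨p, h.1⟩)
  · simpa only [dist_eq_norm] using h.2 w w.2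
  · rintro _ ⟨w, rfl⟩
    exact norm_nonneg _

theorem convex_policySet (S A : Type*) [Fintype A] : Convex ℝ (policySet S A) := by
  intro π hπ π' hπ' a b ha hb hab s
  exact convex_stdSimplex ℝ A (hπ s) (hπ' s) ha hb hab

theorem norm_sub_sq_le_of_mem_policySet {S A : Type*} [Fintype S] [Fintype A]
    {π π' : EuclideanSpace ℝ (S × A)} (hπ : π ∈ policySet S A) (hπ' : π' ∈ policySet S A) :
    ‖π - π'‖ ^ 2 ≤ 2 * Fintype.card S := by
  rw [EuclideanSpace.norm_sq_eq, Fintype.sum_prod_type]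
  have h : ∀ s ∈ (Finset.univ : Finset S), ∑ a, ‖(π - π') (s, a)‖ ^ 2 ≤ 2 := by
    intro s _
    -- For `x, y ∈ [0,1]`, `(x - y)² ≤ x² + y² ≤ x + y`.
    calc ∑ a, ‖(π - π') (s, a)‖ ^ 2 ≤ ∑ a, (π (s, a) + π' (s, a)) := by
          refine Finset.sum_le_sum fun a _ => ?_
          have h1 := (hπ s).1 a
          have h2 := (hπ' s).1 a
          have h3 : π (s, a) ≤ 1 := (hπ s).2 ▸
            Finset.single_le_sum (f := fun a => π (s, a)) (fun a _ => (hπ s).1 a)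
              (Finset.mem_univ a)
          have h4 : π' (s, a) ≤ 1 := (hπ' s).2 ▸
            Finset.single_le_sum (f := fun a => π' (s, a)) (fun a _ => (hπ' s).1 a)
              (Finset.mem_univ a)
          simp only [PiLp.sub_apply, Real.norm_eq_abs, sq_abs] at h1 h2 ⊢
          nlinarith [mul_nonneg h1 h2, mul_nonneg h1 (sub_nonneg.2 h3),
            mul_nonneg h2 (sub_nonneg.2 h4)]
      _ = 2 := by rw [Finset.sum_add_distrib, (hπ s).2, (hπ' s).2]; norm_num
  refine (Finset.sum_le_card_nsmul _ _ _ h).trans_eq ?_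
  rw [nsmul_eq_mul, Finset.card_univ, mul_comm]

namespace MDP

/-! ### Gradient domination through the mismatch coefficient. -/

section Domination

variable {S A : Type*} [Fintype S] [Fintype A] [DecidableEq S]

theorem summable_stateProb (M : MDP S A) {π : EuclideanSpace ℝ (S × A)}
    (hπ : π ∈ policySet S A) (s s' : S) :
    Summable fun t : ℕ => M.γ ^ t * M.stateProb π t s s' :=
  (M.hasSum_resolvent_apply ((M.norm_smul_transMatrix_le hπ).trans_lt M.γ_lt_one) s s').summable

theorem stateProb_nonneg (M : MDP S A) {π : EuclideanSpace ℝ (S × A)}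
    (hπ : π ∈ policySet S A) (t : ℕ) (s s' : S) : 0 ≤ M.stateProb π t s s' := by
  induction t generalizing s' with
  | zero => simp only [stateProb, pow_zero, Matrix.one_apply]; split_ifs <;> norm_num
  | succ t ih =>
    rw [stateProb, pow_succ, Matrix.mul_apply]
    refine Finset.sum_nonneg fun j _ => mul_nonneg (ih j) ?_
    exact Finset.sum_nonneg fun a _ => mul_nonneg ((hπ j).1 a) ((M.P_mem j a).1 s')

theorem resolvent_nonneg (M : MDP S A) {π : EuclideanSpace ℝ (S × A)}
    (hπ : π ∈ policySet S A) (s s' : S) : 0 ≤ M.resolvent π s s' :=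
  tsum_nonneg fun t => mul_nonneg (pow_nonneg M.γ_nonneg t) (M.stateProb_nonneg hπ t s s')

theorem one_le_resolvent_self (M : MDP S A) {π : EuclideanSpace ℝ (S × A)}
    (hπ : π ∈ policySet S A) (s : S) : 1 ≤ M.resolvent π s s := by
  have h := (M.summable_stateProb hπ s s).le_tsum 0 fun t _ =>
    mul_nonneg (pow_nonneg M.γ_nonneg t) (M.stateProb_nonneg hπ t s s)
  simpa [stateProb, resolvent] using h

theorem value_nonneg (M : MDP S A) {π : EuclideanSpace ℝ (S × A)}
    (hπ : π ∈ policySet S A) (s : S) : 0 ≤ M.value π s :=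
  tsum_nonneg fun t => mul_nonneg (pow_nonneg M.γ_nonneg t) <|
    Finset.sum_nonneg fun s' _ => mul_nonneg (M.stateProb_nonneg hπ t s s') <|
      Finset.sum_nonneg fun a _ => mul_nonneg ((hπ s').1 a) (M.r_mem s' a).1

theorem valueOf_nonneg (M : MDP S A) {π : EuclideanSpace ℝ (S × A)}
    (hπ : π ∈ policySet S A) {μ : S → ℝ} (hμ : μ ∈ stdSimplex ℝ S) : 0 ≤ M.valueOf π μ :=
  Finset.sum_nonneg fun s _ => mul_nonneg (hμ.1 s) (M.value_nonneg hπ s)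

theorem valueOf_le [Nonempty S] (M : MDP S A) {π : EuclideanSpace ℝ (S × A)}
    (hπ : π ∈ policySet S A) {μ : S → ℝ} (hμ : μ ∈ stdSimplex ℝ S) :
    M.valueOf π μ ≤ (1 - M.γ)⁻¹ :=
  (le_abs_self _).trans ((abs_dotProduct_le_norm hμ _).trans (M.norm_value_le hπ))

/-- The time-zero term alone contributes `μ`. This lets the fixed `μ` stand in for the visitation
measure of the changing iterate. -/
theorem le_vecMul_resolvent (M : MDP S A) {π : EuclideanSpace ℝ (S × A)}
    (hπ : π ∈ policySet S A) {μ : S → ℝ} (hμ : μ ∈ stdSimplex ℝ S) (s : S) :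
    μ s ≤ Matrix.vecMul μ (M.resolvent π) s :=
  (le_mul_of_one_le_right (hμ.1 s) (M.one_le_resolvent_self hπ s)).trans
    (Finset.single_le_sum (f := fun s' => μ s' * M.resolvent π s' s)
      (fun s' _ => mul_nonneg (hμ.1 s') (M.resolvent_nonneg hπ s' s)) (Finset.mem_univ s))

theorem visitOf_eq (M : MDP S A) (π : EuclideanSpace ℝ (S × A)) (ρ : S → ℝ) (s : S) :
    M.visitOf π ρ s = (1 - M.γ) * Matrix.vecMul ρ (M.resolvent π) s := by
  simp only [visitOf, visit, Matrix.vecMul, dotProduct, resolvent, Matrix.of_apply,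
    Finset.mul_sum]
  exact Finset.sum_congr rfl fun _ _ => mul_left_comm _ _ _

theorem qPairing_congr (M : MDP S A) (θ : EuclideanSpace ℝ (S × A))
    {w w' : EuclideanSpace ℝ (S × A)} {s : S} (h : ∀ a, w (s, a) = w' (s, a)) :
    M.qPairing θ w s = M.qPairing θ w' s := by
  simp only [qPairing, expReward, transMatrix, Pi.add_apply, Pi.smul_apply, Matrix.mulVec,
    dotProduct, Matrix.of_apply, h]

theorem qPairing_zero (M : MDP S A) (θ : EuclideanSpace ℝ (S × A)) (s : S) :
    M.qPairing θ 0 s = 0 := by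
  simp [qPairing, expReward, transMatrix, Matrix.mulVec, dotProduct]

/-- Gradient domination: the suboptimality of `θ` is controlled by a first-order improvement. -/
theorem exists_valueOf_sub_le_dirDeriv (M : MDP S A) {μ ρ : S → ℝ} (hμ : μ ∈ stdSimplex ℝ S)
    (hρn : ρ ∈ stdSimplex ℝ S) {θ π : EuclideanSpace ℝ (S × A)} (hθ : θ ∈ policySet S A) (hπ : π ∈ policySet S A)
    {D : ℝ} (hD : 0 ≤ D) (hDμ : ∀ s, M.visitOf π ρ s ≤ D * μ s) :
    ∃ z ∈ policySet S A,
      M.valueOf π ρ - M.valueOf θ ρ ≤ D / (1 - M.γ) * M.dirDeriv μ θ (z - θ) := by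
  classical
  have h1 : 0 < 1 - M.γ := sub_pos.2 M.γ_lt_one
  set g := M.qPairing θ (π - θ) with hg
  -- Switching to `π` only where this helps turns `g` into its positive part, so enlarging the state
  -- weights can only enlarge the sum.
  let z : EuclideanSpace ℝ (S × A) :=
    WithLp.toLp 2 fun p => if 0 ≤ g p.1 then π p else θ p
  have hz : ∀ s, M.qPairing θ (z - θ) s = max (g s) 0 := by
    intro s
    by_cases h : 0 ≤ g s
    · rw [max_eq_left h, hg]
      exact M.qPairing_congr θ fun a => by simp [z, h]
    · rw [max_eq_right (not_le.1 h).le, ← M.qPairing_zero θ s]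
      exact M.qPairing_congr θ fun a => by simp [z, h]
  refine ⟨z, fun s => ?_, ?_⟩
  · by_cases h : 0 ≤ g s
    · simpa [z, h] using hπ s
    · simpa [z, h] using hθ s
  rw [M.valueOf_sub_valueOf ρ ((M.norm_smul_transMatrix_le hπ).trans_lt M.γ_lt_one)
    ((M.norm_smul_transMatrix_le hθ).trans_lt M.γ_lt_one), dirDeriv_apply,
    Matrix.dotProduct_mulVec, Matrix.dotProduct_mulVec, dotProduct, dotProduct, Finset.mul_sum]
  refine Finset.sum_le_sum fun s _ => ?_
  rw [hz, ← hg]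
  have hmax := le_max_right (g s) 0
  have hρ : Matrix.vecMul ρ (M.resolvent π) s ≤ D / (1 - M.γ) * μ s := by
    rw [div_mul_eq_mul_div, le_div_iff₀ h1, mul_comm, ← visitOf_eq]
    exact hDμ s
  have hρ0 : 0 ≤ Matrix.vecMul ρ (M.resolvent π) s :=
    Finset.sum_nonneg fun s' _ => mul_nonneg (hρn.1 s') (M.resolvent_nonneg hπ s' s)
  calc Matrix.vecMul ρ (M.resolvent π) s * g s
      ≤ Matrix.vecMul ρ (M.resolvent π) s * max (g s) 0 :=
        mul_le_mul_of_nonneg_left (le_max_left _ _) hρ0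
    _ ≤ D / (1 - M.γ) * Matrix.vecMul μ (M.resolvent θ) s * max (g s) 0 := by
        refine mul_le_mul_of_nonneg_right (hρ.trans ?_) hmax
        exact mul_le_mul_of_nonneg_left (M.le_vecMul_resolvent hθ hμ s) (by positivity)
    _ = D / (1 - M.γ) * (Matrix.vecMul μ (M.resolvent θ) s * max (g s) 0) := mul_assoc _ _ _

/-- States with `μ s = 0` are covered: a finite mismatch leaves them no visitation mass. -/
theorem visitOf_le_toReal_mismatch_mul (M : MDP S A) {π : EuclideanSpace ℝ (S × A)}
    {ρ μ : S → ℝ} (hμ : ∀ s, 0 ≤ μ s) (h : M.mismatch π ρ μ ≠ ⊤) (s : S) :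
    M.visitOf π ρ s ≤ (M.mismatch π ρ μ).toReal * μ s := by
  have hle : ENNReal.ofReal (M.visitOf π ρ s) / ENNReal.ofReal (μ s) ≤ M.mismatch π ρ μ :=
    le_iSup (fun s => ENNReal.ofReal (M.visitOf π ρ s) / ENNReal.ofReal (μ s)) s
  have h2 : ENNReal.ofReal (M.visitOf π ρ s) ≤ M.mismatch π ρ μ * ENNReal.ofReal (μ s) := by
    refine (ENNReal.div_le_iff_le_mul (Or.inr h) (Or.inl ENNReal.ofReal_ne_top)).1 hle
  rw [← ENNReal.ofReal_toReal h, ← ENNReal.ofReal_mul ENNReal.toReal_nonneg] at h2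
  exact (ENNReal.ofReal_le_ofReal_iff (mul_nonneg ENNReal.toReal_nonneg (hμ s))).1 h2

end Domination

/-! ### Progress and near-stationarity of projected gradient ascent. -/

section Ascent

variable {S A : Type*} [Fintype S] [Fintype A] [DecidableEq S]

theorem IsProjGradAscent.mem {M : MDP S A} {μ : S → ℝ} {η : ℝ}
    {π : ℕ → EuclideanSpace ℝ (S × A)} (hπ : M.IsProjGradAscent μ η π) :
    ∀ t, π t ∈ policySet S A
  | 0 => hπ.1
  | t + 1 => (hπ.2 t).1

theorem IsProjGradAscent.mul_dirDeriv_le [Nonempty S] {M : MDP S A} {μ : S → ℝ} {η : ℝ}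
    {π : ℕ → EuclideanSpace ℝ (S × A)} (hπ : M.IsProjGradAscent μ η π)
    (hμ : μ ∈ stdSimplex ℝ S) (t : ℕ) {z : EuclideanSpace ℝ (S × A)} (hz : z ∈ policySet S A) :
    η * M.dirDeriv μ (π t) (z - π (t + 1)) ≤ inner ℝ (π (t + 1) - π t) (z - π (t + 1)) := by
  have h := (hπ.2 t).inner_sub_le_zero (convex_policySet S A) hz
  rw [add_sub_right_comm, inner_add_left, real_inner_smul_left,
    M.inner_gradient_valueOf hμ (hπ.mem t), ← neg_sub (π (t + 1)) (π t), inner_neg_left] at h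
  linarith

/-- Sufficient increase of one step of projected gradient ascent. -/
theorem IsProjGradAscent.sq_norm_le_valueOf_sub [Nonempty S] {M : MDP S A} {μ : S → ℝ} {β : ℝ}
    {π : ℕ → EuclideanSpace ℝ (S × A)} (hβ : 0 < β)
    (hβM : 2 * M.γ * Fintype.card A / (1 - M.γ) ^ 3 ≤ β) (hπ : M.IsProjGradAscent μ β⁻¹ π)
    (hμ : μ ∈ stdSimplex ℝ S) (t : ℕ) :
    β / 2 * ‖π (t + 1) - π t‖ ^ 2 ≤ M.valueOf (π (t + 1)) μ - M.valueOf (π t) μ := by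
  have h1 : 0 < 1 - M.γ := sub_pos.2 M.γ_lt_one
  -- Testing the projection inequality at `z = π t` bounds the first-order gain below by `β` times
  -- the squared step; the Taylor remainder costs at most half of it.
  have hd := hπ.mul_dirDeriv_le hμ t (hπ.mem t)
  rw [← neg_sub (π (t + 1)) (π t), map_neg, inner_neg_right, real_inner_self_eq_norm_sq,
    inv_mul_le_iff₀ hβ] at hd
  have hs := M.abs_valueOf_sub_sub_dirDeriv_le hμ
    ((M.norm_smul_transMatrix_le (hπ.mem (t + 1))).trans_lt M.γ_lt_one) (hπ.mem t)
    (M.norm_resolvent_le_of_mem (hπ.mem (t + 1)))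
  have e : (1 - M.γ)⁻¹ * M.γ * Fintype.card A / (1 - M.γ) ^ 2 =
      (2 * M.γ * Fintype.card A / (1 - M.γ) ^ 3) / 2 := by
    field_simp
  rw [e] at hs
  have hs1 := (abs_le.1 hs).1
  have hs2 := mul_le_mul_of_nonneg_right hβM (sq_nonneg ‖π (t + 1) - π t‖)
  linarith

/-- Near-stationarity of the iterate after a short step. -/
theorem IsProjGradAscent.dirDeriv_le [Nonempty S] {M : MDP S A} {μ : S → ℝ} {β : ℝ}
    {π : ℕ → EuclideanSpace ℝ (S × A)} (hβ : 0 < β)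
    (hβM : 2 * M.γ * Fintype.card A / (1 - M.γ) ^ 3 ≤ β) (hπ : M.IsProjGradAscent μ β⁻¹ π)
    (hμ : μ ∈ stdSimplex ℝ S) (t : ℕ) {z : EuclideanSpace ℝ (S × A)} (hz : z ∈ policySet S A) :
    M.dirDeriv μ (π (t + 1)) (z - π (t + 1)) ≤
      2 * β * ‖π (t + 1) - π t‖ * ‖z - π (t + 1)‖ := by
  have hd := hπ.mul_dirDeriv_le hμ t hz
  rw [inv_mul_le_iff₀ hβ] at hd
  have hi := mul_le_mul_of_nonneg_left
    (real_inner_le_norm (π (t + 1) - π t) (z - π (t + 1))) hβ.le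
  -- The projection controls the gradient at `π t`; moving it to `π (t + 1)` costs a second `β`,
  -- whence `2 * β`.
  have hs := (abs_le.1 (M.abs_dirDeriv_sub_le hμ (hπ.mem (t + 1)) (hπ.mem t)
    (z - π (t + 1)))).2
  have hs2 := mul_le_mul_of_nonneg_right (mul_le_mul_of_nonneg_right hβM
    (norm_nonneg (π (t + 1) - π t))) (norm_nonneg (z - π (t + 1)))
  linarith

theorem IsProjGradAscent.exists_sq_norm_le [Nonempty S] {M : MDP S A} {μ : S → ℝ} {β : ℝ}
    {π : ℕ → EuclideanSpace ℝ (S × A)} (hβ : 0 < β)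
    (hβM : 2 * M.γ * Fintype.card A / (1 - M.γ) ^ 3 ≤ β) (hπ : M.IsProjGradAscent μ β⁻¹ π)
    (hμ : μ ∈ stdSimplex ℝ S) {n : ℕ} (hn : 0 < n) :
    ∃ t < n, n * (β / 2 * ‖π (t + 1) - π t‖ ^ 2) ≤ (1 - M.γ)⁻¹ := by
  have hn' : (0 : ℝ) < n := Nat.cast_pos.2 hn
  have hsum : ∑ t ∈ Finset.range n, β / 2 * ‖π (t + 1) - π t‖ ^ 2 ≤
      ∑ _t ∈ Finset.range n, (1 - M.γ)⁻¹ / n := by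
    calc _ ≤ ∑ t ∈ Finset.range n, (M.valueOf (π (t + 1)) μ - M.valueOf (π t) μ) :=
          Finset.sum_le_sum fun t _ => hπ.sq_norm_le_valueOf_sub hβ hβM hμ t
      _ = M.valueOf (π n) μ - M.valueOf (π 0) μ :=
          Finset.sum_range_sub (fun t => M.valueOf (π t) μ) n
      _ ≤ (1 - M.γ)⁻¹ := by
          linarith [M.valueOf_le (hπ.mem n) hμ, M.valueOf_nonneg (hπ.mem 0) hμ]
      _ = _ := by
          rw [Finset.sum_const, Finset.card_range, nsmul_eq_mul, mul_div_cancel₀ _ hn'.ne']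
  obtain ⟨t, ht, h⟩ := Finset.exists_le_of_sum_le (by simpa using hn.ne') hsum
  refine ⟨t, Finset.mem_range.1 ht, ?_⟩
  rwa [le_div_iff₀ hn', mul_comm] at h

end Ascent

end MDP

theorem mainTheorem4 {S A : Type*} [Fintype S] [Fintype A] [DecidableEq S]
    (M : MDP S A) (hγ : 0 < M.γ)
    (μ : S → ℝ) (hμ : μ ∈ stdSimplex ℝ S)
    (π : ℕ → EuclideanSpace ℝ (S × A))
    (hπ : M.IsProjGradAscent μ ((1 - M.γ) ^ 3 / (2 * M.γ * (Fintype.card A : ℝ))) π)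
    (ρ : S → ℝ) (hρ : ρ ∈ stdSimplex ℝ S)
    (πstar : EuclideanSpace ℝ (S × A)) (hstar : M.IsOptimalFor ρ πstar)
    (ε : ℝ) (hε : 0 < ε) (T : ℕ) (hT2 : 2 ≤ T)
    (hT : ENNReal.ofReal (64 * M.γ * (Fintype.card S : ℝ) * (Fintype.card A : ℝ) /
        ((1 - M.γ) ^ 6 * ε ^ 2)) * M.mismatch πstar ρ μ ^ 2 < (T : ENNReal)) :
    ∃ t < T, M.valueOf πstar ρ - M.valueOf (π t) ρ ≤ ε := by
  have h1 : 0 < 1 - M.γ := sub_pos.2 M.γ_lt_one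
  have : Nonempty S := by
    by_contra h
    have := not_nonempty_iff.1 h
    simpa using hμ.2
  have : Nonempty A := by
    by_contra h
    have := not_nonempty_iff.1 h
    simpa using (hπ.1 (Classical.arbitrary S)).2
  have hS : (0 : ℝ) < Fintype.card S := Nat.cast_pos.2 Fintype.card_pos
  have hA : (0 : ℝ) < Fintype.card A := Nat.cast_pos.2 Fintype.card_pos
  set c : ℝ := 64 * M.γ * (Fintype.card S : ℝ) * (Fintype.card A : ℝ) /
    ((1 - M.γ) ^ 6 * ε ^ 2) with hc
  have hc0 : 0 < c := by positivity
  have hm : M.mismatch πstar ρ μ ≠ ⊤ := by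
    intro h
    rw [h, ENNReal.top_pow two_ne_zero,
      ENNReal.mul_top (ENNReal.ofReal_pos.2 hc0).ne'] at hT
    exact not_top_lt hT
  set D := (M.mismatch πstar ρ μ).toReal with hD
  have hD0 : 0 ≤ D := ENNReal.toReal_nonneg
  have hTD : c * D ^ 2 < T := by
    have h := ENNReal.toReal_strict_mono (ENNReal.natCast_ne_top T) hT
    rwa [ENNReal.toReal_mul, ENNReal.toReal_ofReal hc0.le, ENNReal.toReal_pow,
      ENNReal.toReal_natCast] at h
  set β : ℝ := 2 * M.γ * Fintype.card A / (1 - M.γ) ^ 3 with hβ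
  have hβ0 : 0 < β := by positivity
  rw [← inv_div, ← hβ] at hπ
  -- The good iterate is the endpoint `t + 1`, which must stay below `T`, so only `T - 1` steps are
  -- available.
  obtain ⟨t, ht, hat⟩ := hπ.exists_sq_norm_le hβ0 hβ.ge hμ (n := T - 1) (by omega)
  refine ⟨t + 1, by omega, ?_⟩
  obtain ⟨z, hz, hgap⟩ := M.exists_valueOf_sub_le_dirDeriv hμ hρ (hπ.mem (t + 1)) hstar.1 hD0
    (M.visitOf_le_toReal_mismatch_mul hμ.1 hm)
  have hdir := hπ.dirDeriv_le hβ0 hβ.ge hμ t hz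
  have hzn := norm_sub_sq_le_of_mem_policySet hz (hπ.mem (t + 1))
  set a := ‖π (t + 1) - π t‖
  set b := ‖z - π (t + 1)‖
  refine (hgap.trans (mul_le_mul_of_nonneg_left hdir (by positivity))).trans ?_
  refine (abs_le_of_sq_le_sq' ?_ hε.le).2
  -- Passing from `T - 1` to `T` costs a factor 2, valid since `T ≥ 2`; it is part of the constant
  -- 64.
  have hn : (T : ℝ) ≤ 2 * ((T - 1 : ℕ) : ℝ) := by
    exact_mod_cast (by omega : T ≤ 2 * (T - 1))
  have hTpos : (0 : ℝ) < T := by positivity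
  have ha : T * (β * a ^ 2) ≤ 4 * (1 - M.γ)⁻¹ := by
    have := mul_le_mul_of_nonneg_right hn (by positivity : 0 ≤ β * a ^ 2)
    linarith
  have hcD : 64 * M.γ * Fintype.card S * Fintype.card A / (1 - M.γ) ^ 6 * D ^ 2 ≤ T * ε ^ 2 := by
    have e : 64 * M.γ * Fintype.card S * Fintype.card A / (1 - M.γ) ^ 6 * D ^ 2 =
        c * D ^ 2 * ε ^ 2 := by
      rw [hc]; field_simp
    rw [e]
    exact mul_le_mul_of_nonneg_right hTD.le (sq_nonneg ε)
  refine le_of_mul_le_mul_left (le_trans ?_ hcD) hTpos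
  calc T * (D / (1 - M.γ) * (2 * β * a * b)) ^ 2
      = 4 * (D / (1 - M.γ)) ^ 2 * β * ((T * (β * a ^ 2)) * b ^ 2) := by ring
    _ ≤ 4 * (D / (1 - M.γ)) ^ 2 * β * ((4 * (1 - M.γ)⁻¹) * (2 * Fintype.card S)) := by gcongr
    _ = 64 * M.γ * Fintype.card S * Fintype.card A / (1 - M.γ) ^ 6 * D ^ 2 := by
        rw [hβ]; field_simp; ring
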